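/- Let $\mathfrak g=\mathfrak g(A)$ be a Kac–Moody algebra over $\mathbb C$ whose generalized Cartan matrix $A=(a_{\alpha\beta})_{\alpha,\beta\in\Pi}$ (with finite non-empty index set, the set $\Pi$ of simple roots) is symmetrizable and indecomposable. Let $\mathfrak h$ be its Cartan subalgebra, with simple roots $\alpha\in\Pi\subset\mathfrak h^*$ and simple coroots $\alpha^\vee\in\mathfrak h$. Let $W\subset GL(\mathfrak h^*)$ be the Weyl group, generated by the simple reflections $s_\alpha(\nu)=\nu-\langle\nu,\alpha^\vee\rangle\alpha$, and let $\varepsilon:W\to\{\pm1\}$ be its sign character, $\varepsilon(s_\alpha)=-1$. Let $P^+=\{\lambda\in\mathfrak h^*:\langle\lambda,\alpha^\vee\rangle\in\mathbb Z_{\ge 0}\text{ for all }\alpha\in\Pi\}$ be the set of dominant integral weights, and let $\rho\in\mathfrak h^*$ satisfy $\langle\rho,\alpha^\vee\rangle=1$ for all $\alpha\in\Pi$. Put $X_\alpha=e^{-\alpha}$ for $\alpha\in\Pi$ and $\mathcal A=\mathbb C[[X_\alpha:\alpha\in\Pi]]$. For $\lambda\in P^+$ define the normalized Weyl numerator $$U_\lambda=e^{-(\lambda+\rho)}\sum_{w\in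 W}\varepsilon(w)\,e^{w(\lambda+\rho)}\in\mathcal A .$$ Let $n,m$ be positive integers and suppose that $\lambda_1,\dots,\lambda_n,\mu_1,\dots,\mu_m\in P^+$ satisfy $$U_{\lambda_1}\cdots U_{\lambda_n}=U_{\mu_1}\cdots U_{\mu_m}\quad\text{in }\mathcal A.$$ Then $n=m$, and there is a permutation $\sigma$ of $\{1,\dots,n\}$ such that $U_{\lambda_i}=U_{\mu_{\sigma(i)}}$ for $1\le i\le n$. -/

import Mathlib

/-- A generalized Cartan matrix: `a i i = 2`, `a i j ≤ 0` for `i ≠ j`, and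
`a i j = 0` implies `a j i = 0`. -/
structure IsGeneralizedCartanMatrix {ι : Type*} (A : Matrix ι ι ℤ) : Prop where
  diag : ∀ i, A i i = 2
  nonpos : ∀ i j, i ≠ j → A i j ≤ 0
  zero_symm : ∀ i j, A i j = 0 → A j i = 0

/-- `A` is symmetrizable: `A = D * B` with `D` an invertible diagonal matrix and `B` a symmetric
matrix, over the complex numbers. -/
def IsSymmetrizableMatrix {ι : Type*} [Fintype ι] [DecidableEq ι] (A : Matrix ι ι ℤ) : Prop :=
  ∃ (d : ι → ℂ) (B : Matrix ι ι ℂ),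
    (∀ i, d i ≠ 0) ∧ B.IsSymm ∧ A.map (Int.cast : ℤ → ℂ) = Matrix.diagonal d * B

/-- `A` is indecomposable: the index set is non-empty and is not the union of two disjoint
non-empty subsets `S` and `Sᶜ` with `a i j = a j i = 0` whenever `i ∈ S` and `j ∉ S`. -/
def IsIndecomposableMatrix {ι : Type*} (A : Matrix ι ι ℤ) : Prop :=
  Nonempty ι ∧ ∀ S : Set ι, S.Nonempty → Sᶜ.Nonempty →
    ∃ i ∈ S, ∃ j ∈ Sᶜ, A i j ≠ 0 ∨ A j i ≠ 0

/-- A realization `(H, Π, Πᵛ)` of a square matrix `A`, over the complex numbers: linearly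
independent simple roots `Π` in the dual of the finite-dimensional space `H` and linearly
independent simple coroots `Πᵛ` in `H` such that `⟨αⱼ, αᵢᵛ⟩ = a i j` and
`dim H = 2 |ι| - rank A`. -/
structure CartanRealization {ι : Type*} [Fintype ι] (A : Matrix ι ι ℤ)
    (H : Type*) [AddCommGroup H] [Module ℂ H] where
  finiteDimensional : FiniteDimensional ℂ H
  root : ι → Module.Dual ℂ H
  coroot : ι → H
  root_linearIndependent : LinearIndependent ℂ root
  coroot_linearIndependent : LinearIndependent ℂ coroot
  root_coroot : ∀ i j, root j (coroot i) = (A i j : ℂ)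
  finrank_add_rank :
    Module.finrank ℂ H + (A.map (Int.cast : ℤ → ℂ)).rank = 2 * Fintype.card ι

/-- The structure of a Kac-Moody algebra with Cartan matrix `A` on a complex Lie algebra `𝔤`: a
commutative subalgebra `cartan` with a realization of `A` in it, and Chevalley generators `e i`,
`f i` which satisfy the Chevalley relations and generate `𝔤` together with `cartan`, such that no
non-zero ideal of `𝔤` meets `cartan` trivially. These properties characterize, up to isomorphism,
the Lie algebra `𝔤(A)` with its Cartan subalgebra, simple roots and simple coroots. -/
structure KacMoodyAlgebra {ι : Type*} [Fintype ι] (A : Matrix ι ι ℤ)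
    (𝔤 : Type*) [LieRing 𝔤] [LieAlgebra ℂ 𝔤] where
  cartan : LieSubalgebra ℂ 𝔤
  realization : CartanRealization A cartan
  e : ι → 𝔤
  f : ι → 𝔤
  lie_cartan : ∀ h h' : cartan, ⁅(h : 𝔤), (h' : 𝔤)⁆ = 0
  lie_e_f_same : ∀ i, ⁅e i, f i⁆ = (realization.coroot i : 𝔤)
  lie_e_f_ne : ∀ i j, i ≠ j → ⁅e i, f j⁆ = 0
  lie_h_e : ∀ (h : cartan) (i : ι), ⁅(h : 𝔤), e i⁆ = realization.root i h • e i
  lie_h_f : ∀ (h : cartan) (i : ι), ⁅(h : 𝔤), f i⁆ = -(realization.root i h • f i)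
  generated :
    LieSubalgebra.lieSpan ℂ 𝔤 ((cartan : Set 𝔤) ∪ Set.range e ∪ Set.range f) = ⊤
  ideal_eq_bot : ∀ I : LieIdeal ℂ 𝔤, (∀ x ∈ I, x ∈ cartan → x = 0) → I = ⊥

namespace CartanRealization

variable {ι : Type*} [Fintype ι] {A : Matrix ι ι ℤ} {H : Type*} [AddCommGroup H] [Module ℂ H]

/-- The simple reflection `s i` of the dual of `H`, that is `ν ↦ ν - ⟨ν, αᵢᵛ⟩ αᵢ`. -/
noncomputable def simpleReflection (R : CartanRealization A H) (hA : IsGeneralizedCartanMatrix A)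
    (i : ι) : Module.Dual ℂ H ≃ₗ[ℂ] Module.Dual ℂ H :=
  Module.reflection (x := R.root i) (f := Module.Dual.eval ℂ H (R.coroot i)) (by
    rw [Module.Dual.eval_apply, R.root_coroot, hA.diag]; norm_num)

theorem simpleReflection_apply (R : CartanRealization A H) (hA : IsGeneralizedCartanMatrix A)
    (i : ι) (ν : Module.Dual ℂ H) :
    R.simpleReflection hA i ν = ν - ν (R.coroot i) • R.root i := by
  simp [simpleReflection, Module.reflection_apply]

/-- The Weyl group: the group of automorphisms of the dual of `H` generated by the simple
reflections. -/
def weylGroup (R : CartanRealization A H) (hA : IsGeneralizedCartanMatrix A) :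
    Subgroup (Module.Dual ℂ H ≃ₗ[ℂ] Module.Dual ℂ H) :=
  Subgroup.closure (Set.range (R.simpleReflection hA))

/-- The sign character of the Weyl group, `w ↦ det w`; it takes the value `-1` at every simple
reflection (`sign_simpleReflection`). -/
noncomputable def sign (R : CartanRealization A H) (hA : IsGeneralizedCartanMatrix A) :
    R.weylGroup hA →* ℂˣ :=
  LinearEquiv.det.comp (R.weylGroup hA).subtype

theorem sign_simpleReflection (R : CartanRealization A H) (hA : IsGeneralizedCartanMatrix A)
    (i : ι) :
    R.sign hA ⟨R.simpleReflection hA i, Subgroup.subset_closure ⟨i, rfl⟩⟩ = -1 := by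
  have := R.finiteDimensional
  have h : (R.simpleReflection hA i : Module.Dual ℂ H →ₗ[ℂ] Module.Dual ℂ H) =
      LinearMap.transvection (Module.Dual.eval ℂ H (R.coroot i)) (-R.root i) := by
    refine LinearMap.ext fun ν => ?_
    simp [simpleReflection_apply, LinearMap.transvection.apply, sub_eq_add_neg]
  refine Units.ext ?_
  simp only [sign, MonoidHom.comp_apply, Subgroup.subtype_apply, LinearEquiv.coe_det, h,
    LinearMap.transvection.det]
  simp [R.root_coroot, hA.diag]
  norm_num

/-- The set `P⁺` of dominant integral weights. -/
def dominantWeights (R : CartanRealization A H) : Set (Module.Dual ℂ H) :=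
  {ν | ∀ i, ∃ k : ℕ, ν (R.coroot i) = k}

/-- `ρ` is a Weyl vector: `⟨ρ, αᵢᵛ⟩ = 1` for every `i`. -/
def IsWeylVector (R : CartanRealization A H) (ρ : Module.Dual ℂ H) : Prop :=
  ∀ i, ρ (R.coroot i) = 1

/-- The normalized Weyl numerator `e^{-(ν + ρ)} ∑ w, ε(w) e^{w(ν + ρ)}` as a power series in the
variables `X i = e^{-αᵢ}`. The coefficient of `∏ i, X i ^ d i` is the sum of the signs of the
elements `w` of the Weyl group with `(ν + ρ) - w (ν + ρ) = ∑ i, d i • αᵢ`. For dominant `ν` the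
stabilizer of `ν + ρ` is trivial, so that at most one `w` contributes to a coefficient, and
`(ν + ρ) - w (ν + ρ)` is a sum of simple roots, so that every `w` contributes to exactly one. -/
noncomputable def weylNumerator (R : CartanRealization A H) (hA : IsGeneralizedCartanMatrix A)
    (ρ ν : Module.Dual ℂ H) : MvPowerSeries ι ℂ :=
  fun d => ∑ᶠ (w : R.weylGroup hA)
    (_ : (ν + ρ) - (w : Module.Dual ℂ H ≃ₗ[ℂ] Module.Dual ℂ H) (ν + ρ) = ∑ i, d i • R.root i),
    (R.sign hA w : ℂ)

end CartanRealization

/-! Put `k i = ⟨ν + ρ, αᵢᵛ⟩ ≥ 1`. In every monomial of the numerator of `ν`, the exponent of `X i`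
is `0` or at least `k i`. At the corner exponents, equal to `k` on a set `I` and `0` elsewhere, the
coefficient is `(-1) ^ #I` if `I` is independent in the Dynkin diagram and `0` otherwise
(`weylNumerator_supportedAbove`, `coeff_weylNumerator_restrictExponent`). Both facts come from
expanding `Λ - w Λ` along a reduced word of `w` (`exists_sub_wordProd_apply_eq`), where positivity
of roots is needed (`apply_root_mem_closure`).

A logarithmic derivative turns the equality of products into an equality of sums. The log derivative
of a numerator keeps the exponent gap, and its coefficient at `X ^ k` is nonzero because the diagram
is connected: up to the factor `-k i` it counts heaps on the diagram that use each vertex once and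
have `i` as only maximal piece (`sum_indepSign_mem_mul_neg`). A numerator with exponent `k'` reaches
the monomial `X ^ k` only if `k' ≤ k`, so induction on `k` shows that each `k` occurs equally often
on both sides. Finally `k` determines the numerator (`weylNumerator_congr`). -/

open Finset in
/-- The signed indicator function of independent sets of a graph. -/
noncomputable def indepSign {ι : Type*} (R : Type*) [CommRing R] (G : SimpleGraph ι)
    (J : Finset ι) : R :=
  open Classical in if G.IsIndepSet (J : Set ι) then (-1) ^ #J else 0

/-- The sum of `u J * f (I \ J)` over the subsets `J` of `I` that avoid `S`, where `u` is the
signed indicator function of independent sets. -/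
noncomputable def avoidSum {ι : Type*} {R : Type*} [CommRing R] (G : SimpleGraph ι)
    (f : Finset ι → R) (S : Set ι) (I : Finset ι) : R :=
  open Classical in
  ∑ J ∈ I.powerset, if Disjoint (J : Set ι) S then indepSign R G J * f (I \ J) else 0

/-- The set of vertices adjacent to an element of `T`. -/
def outerBoundary {ι : Type*} (G : SimpleGraph ι) (T : Set ι) : Set ι := {v | ∃ t ∈ T, G.Adj t v}

/-! ### Independence series of a graph and positivity of heap counts. -/

section Graph

open Finset Classical

variable {ι : Type*} {R : Type*} [CommRing R] (G : SimpleGraph ι)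

theorem indepSign_of_subset_of_not_indep {T J : Finset ι} (hT : ¬ G.IsIndepSet (T : Set ι))
    (h : T ⊆ J) : indepSign R G J = 0 := by
  rw [indepSign, if_neg]
  exact fun hJ => hT (hJ.mono (by exact_mod_cast h))

theorem indepSign_union {T J : Finset ι} (hT : G.IsIndepSet (T : Set ι)) (hd : Disjoint T J) :
    indepSign R G (T ∪ J) =
      if Disjoint (J : Set ι) (outerBoundary G T) then (-1) ^ #T * indepSign R G J else 0 := by
  have key : G.IsIndepSet ((T ∪ J : Finset ι) : Set ι) ↔
      G.IsIndepSet (J : Set ι) ∧ Disjoint (J : Set ι) (outerBoundary G T) := by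
    constructor
    · refine fun h => ⟨h.mono (by simp), Set.disjoint_left.2 ?_⟩
      rintro v hv ⟨t, ht, htv⟩
      exact h (by simp_all) (by simp_all) htv.ne htv
    · rintro ⟨hJ, hB⟩
      have hB' : ∀ t ∈ T, ∀ v ∈ J, ¬ G.Adj t v := fun t ht v hv htv =>
        Set.disjoint_left.1 hB hv ⟨t, ht, htv⟩
      intro a ha b hb hab
      simp only [coe_union, Set.mem_union, mem_coe] at ha hb
      rcases ha with ha | ha <;> rcases hb with hb | hb
      · exact hT ha hb hab
      · exact hB' a ha b hb
      · exact fun h => hB' b hb a ha h.symm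
      · exact hJ ha hb hab
  by_cases hB : Disjoint (J : Set ι) (outerBoundary G T)
  · by_cases hJ : G.IsIndepSet (J : Set ι)
    · rw [if_pos hB, indepSign, indepSign, if_pos (key.2 ⟨hJ, hB⟩), if_pos hJ,
        card_union_of_disjoint hd, pow_add]
    · rw [if_pos hB, indepSign, indepSign, if_neg (fun h => hJ (key.1 h).1), if_neg hJ, mul_zero]
  · rw [if_neg hB, indepSign, if_neg (fun h => hB (key.1 h).2)]

/-- The substitution `J ↦ T ∪ J` brings the terms of all `T` to the common factor `f (I \ J)`, so
that sums over `T` and `J` can be exchanged. -/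
theorem avoidSum_outerBoundary (f : Finset ι → R) {T I : Finset ι} (hTI : T ⊆ I)
    (hT : G.IsIndepSet (T : Set ι)) :
    avoidSum G f (outerBoundary G T) (I \ T) =
      ∑ J ∈ I.powerset, if T ⊆ J then (-1) ^ #T * (indepSign R G J * f (I \ J)) else 0 := by
  rw [avoidSum, ← sum_filter (fun J : Finset ι => T ⊆ J)]
  refine sum_bij' (fun (J : Finset ι) _ => T ∪ J) (fun (J : Finset ι) _ => J \ T) ?_ ?_ ?_ ?_ ?_
  · intro J hJ
    rw [mem_powerset] at hJ
    simp only [mem_filter, mem_powerset]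
    exact ⟨union_subset hTI (hJ.trans sdiff_subset), subset_union_left⟩
  · intro J hJ
    simp only [mem_filter, mem_powerset] at hJ ⊢
    exact sdiff_subset_sdiff hJ.1 le_rfl
  · intro J hJ
    rw [mem_powerset] at hJ
    exact union_sdiff_cancel_left (disjoint_of_subset_right hJ disjoint_sdiff)
  · intro J hJ
    simp only [mem_filter, mem_powerset] at hJ
    exact union_sdiff_of_subset hJ.2
  · intro J hJ
    rw [mem_powerset] at hJ
    rw [indepSign_union G hT (disjoint_of_subset_right hJ disjoint_sdiff), sdiff_sdiff_left]
    split_ifs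
    · rw [mul_assoc, ← mul_assoc, ← mul_pow]
      simp [sup_eq_union]
    · simp

/-- After exchanging the sums, `J` carries the weight `∑ (-1) ^ #T` over `T ⊆ J ∩ S`, which vanishes
unless `J` avoids `S`. When `f` inverts the independence series, `avoidSum` counts heaps on `I` with
all maximal pieces in `S`. The identity then removes the layer `T` of maximal pieces: those of the
remaining heap must be adjacent to `T`. -/
theorem avoidSum_eq_sum (f : Finset ι → R) (S : Set ι) (I : Finset ι) :
    avoidSum G f S I =
      ∑ T ∈ I.powerset, if G.IsIndepSet (T : Set ι) ∧ (T : Set ι) ⊆ S then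
        avoidSum G f (outerBoundary G T) (I \ T) else 0 := by
  have h1 : ∀ T ∈ I.powerset, (if G.IsIndepSet (T : Set ι) ∧ (T : Set ι) ⊆ S then
        avoidSum G f (outerBoundary G T) (I \ T) else 0) =
      ∑ J ∈ I.powerset, if T ⊆ J ∧ (T : Set ι) ⊆ S then
        (-1) ^ #T * (indepSign R G J * f (I \ J)) else 0 := by
    intro T hT
    rw [mem_powerset] at hT
    by_cases hS : (T : Set ι) ⊆ S
    · by_cases hi : G.IsIndepSet (T : Set ι)
      · simp only [hi, hS, and_self, and_true, if_true]
        exact avoidSum_outerBoundary G f hT hi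
      · rw [if_neg (fun h => hi h.1)]
        refine (sum_eq_zero fun J hJ => ?_).symm
        split_ifs with h
        · rw [indepSign_of_subset_of_not_indep G hi h.1]
          simp
        · rfl
    · simp [hS]
  rw [sum_congr rfl h1, sum_comm, avoidSum]
  refine sum_congr rfl fun J hJ => ?_
  rw [mem_powerset] at hJ
  rw [← sum_filter, ← sum_mul]
  have h2 : {T ∈ I.powerset | T ⊆ J ∧ (T : Set ι) ⊆ S} =
      ({v ∈ J | v ∈ S} : Finset ι).powerset := by
    ext T
    simp only [mem_filter, mem_powerset, subset_iff, Set.subset_def, mem_coe]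
    grind
  have h3 : ∑ T ∈ ({v ∈ J | v ∈ S} : Finset ι).powerset, (-1 : R) ^ #T =
      if ({v ∈ J | v ∈ S} : Finset ι) = ∅ then 1 else 0 := by
    have := congrArg (Int.cast : ℤ → R)
      (sum_powerset_neg_one_pow_card (x := ({v ∈ J | v ∈ S} : Finset ι)))
    push_cast at this
    exact this
  have h4 : ({v ∈ J | v ∈ S} : Finset ι) = ∅ ↔ Disjoint (J : Set ι) S := by
    simp [filter_eq_empty_iff, Set.disjoint_left]
  rw [h2, h3]
  simp only [h4, ite_mul, one_mul, zero_mul]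

theorem avoidSum_empty_right (f : Finset ι → R) (S : Set ι)
    (hf : ∀ I, ∑ J ∈ I.powerset, indepSign R G J * f (I \ J) = if I = ∅ then 1 else 0) :
    avoidSum G f S ∅ = 1 := by
  have := hf ∅
  simpa [avoidSum] using this

theorem avoidSum_empty_left (f : Finset ι → R) {I : Finset ι} (hI : I.Nonempty)
    (hf : ∀ I, ∑ J ∈ I.powerset, indepSign R G J * f (I \ J) = if I = ∅ then 1 else 0) :
    avoidSum G f ∅ I = 0 := by
  have := hf I
  rw [if_neg hI.ne_empty] at this
  simpa [avoidSum] using this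

/-- The condition for positivity says that every connected component of the graph induced on `I`
meets `S`. Induction on `I` by the layer recursion: the layer `T = ∅` contributes `0`, every other
layer leaves a smaller set. -/
theorem avoidSum_nonneg_and_pos [PartialOrder R] [IsStrictOrderedRing R] (f : Finset ι → R)
    (hf : ∀ I, ∑ J ∈ I.powerset, indepSign R G J * f (I \ J) = if I = ∅ then 1 else 0)
    (I : Finset ι) : ∀ S : Set ι, 0 ≤ avoidSum G f S I ∧
      ((∀ K ⊆ I, K.Nonempty → Disjoint (K : Set ι) S → ∃ a ∈ K, ∃ b ∈ I \ K, G.Adj a b) →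
        0 < avoidSum G f S I) := by
  induction I using Finset.strongInduction with
  | H I ih =>
  intro S
  rcases I.eq_empty_or_nonempty with rfl | hI
  · rw [avoidSum_empty_right G f S hf]
    exact ⟨zero_le_one, fun _ => zero_lt_one⟩
  have hterm : ∀ T ∈ I.powerset, 0 ≤ if G.IsIndepSet (T : Set ι) ∧ (T : Set ι) ⊆ S then
        avoidSum G f (outerBoundary G T) (I \ T) else 0 := by
    intro T hT
    rw [mem_powerset] at hT
    split_ifs
    · rcases T.eq_empty_or_nonempty with rfl | hT0
      · have : outerBoundary G ((∅ : Finset ι) : Set ι) = ∅ := by simp [outerBoundary]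
        rw [this, sdiff_empty, avoidSum_empty_left G f hI hf]
      · exact (ih _ (sdiff_ssubset hT hT0) _).1
    · rfl
  rw [avoidSum_eq_sum]
  refine ⟨sum_nonneg hterm, fun hC => ?_⟩
  -- A largest layer `T` gives a positive term: by maximality, a set in `I \ T` that avoids the
  -- boundary of `T` also avoids `S`, so the connectivity condition passes to `I \ T`.
  obtain ⟨T, hTmem, hTmax⟩ := exists_max_image
    (I.powerset.filter fun T : Finset ι => G.IsIndepSet (T : Set ι) ∧ (T : Set ι) ⊆ S) card
    ⟨∅, by simp⟩
  simp only [mem_filter, mem_powerset] at hTmem hTmax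
  obtain ⟨hTI, hTi, hTS⟩ := hTmem
  have hmax : ∀ s ∈ I, s ∈ S → s ∉ T → s ∈ outerBoundary G T := by
    intro s hsI hsS hsT
    by_contra hs
    have h1 : G.IsIndepSet ((insert s T : Finset ι) : Set ι) := by
      rw [coe_insert]
      refine Set.pairwise_insert.2 ⟨hTi, fun t ht _ => ⟨fun h => ?_, fun h => ?_⟩⟩
      · exact hs ⟨t, ht, h.symm⟩
      · exact hs ⟨t, ht, h⟩
    have h2 := hTmax (insert s T) ⟨insert_subset hsI hTI, h1, by
      rw [coe_insert]; exact Set.insert_subset hsS hTS⟩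
    rw [card_insert_of_notMem hsT] at h2
    omega
  have hT0 : T.Nonempty := by
    obtain ⟨a, ha, b, hb, -⟩ | ⟨s, hsI, hsS⟩ :
        (∃ a ∈ I, ∃ b ∈ I \ I, G.Adj a b) ∨ ∃ s ∈ I, s ∈ S := by
      by_cases h : Disjoint (I : Set ι) S
      · exact Or.inl (hC I le_rfl hI h)
      · rw [Set.not_disjoint_iff] at h
        exact Or.inr (by simpa using h)
    · simp at hb
    · by_contra h
      rw [not_nonempty_iff_eq_empty] at h
      subst h
      obtain ⟨t, ht, -⟩ := hmax s hsI hsS (by simp)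
      simp at ht
  refine sum_pos' hterm ⟨T, mem_powerset.2 hTI, ?_⟩
  rw [if_pos ⟨hTi, hTS⟩]
  refine (ih _ (sdiff_ssubset hTI hT0) _).2 fun K hK hK0 hKB => ?_
  have hKI : K ⊆ I := hK.trans sdiff_subset
  have hKS : Disjoint (K : Set ι) S := by
    rw [Set.disjoint_left]
    intro s hsK hsS
    exact Set.disjoint_left.1 hKB hsK (hmax s (hKI hsK) hsS (mem_sdiff.1 (hK hsK)).2)
  obtain ⟨a, ha, b, hb, hab⟩ := hC K hKI hK0 hKS
  refine ⟨a, ha, b, ?_, hab⟩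
  rw [mem_sdiff] at hb
  simp only [mem_sdiff, hb.1, hb.2, not_false_eq_true, and_true, true_and]
  exact fun hbT => Set.disjoint_left.1 hKB ha ⟨b, hbT, hab.symm⟩

/-- The coefficient of full support in the logarithmic derivative of the independence series of a
connected graph is negative. -/
theorem sum_indepSign_mem_mul_neg [Fintype ι] [PartialOrder R] [IsStrictOrderedRing R]
    (f : Finset ι → R)
    (hf : ∀ I, ∑ J ∈ I.powerset, indepSign R G J * f (I \ J) = if I = ∅ then 1 else 0)
    (hG : ∀ K : Finset ι, K.Nonempty → K ≠ univ → ∃ a ∈ K, ∃ b ∉ K, G.Adj a b) (i : ι) :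
    ∑ J ∈ (univ : Finset ι).powerset,
      (if i ∈ J then indepSign R G J else 0) * f (univ \ J) < 0 := by
  have h1 := hf univ
  rw [if_neg (univ_nonempty_iff.2 ⟨i⟩).ne_empty] at h1
  have h2 := (avoidSum_nonneg_and_pos G f hf univ {i}).2 (by
    intro K _ hK0 hKi
    obtain ⟨a, ha, b, hb, hab⟩ := hG K hK0 (by rintro rfl; simp at hKi)
    exact ⟨a, ha, b, by simpa using hb, hab⟩)
  -- The sets with and without `i` together give the full convolution, which is zero.
  have h3 : ∑ J ∈ (univ : Finset ι).powerset,
      (if i ∈ J then indepSign R G J else 0) * f (univ \ J) + avoidSum G f {i} univ = 0 := by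
    refine Eq.trans ?_ h1
    rw [avoidSum, ← sum_add_distrib]
    refine sum_congr rfl fun J _ => ?_
    by_cases h : i ∈ J <;> simp [h]
  rw [eq_neg_of_add_eq_zero_left h3]
  exact neg_neg_of_pos h2

end Graph

/-! ### Power series with exponent gaps and their logarithmic derivatives. -/

section PowerSeries

open Finset MvPowerSeries

variable {ι : Type*}

/-- In every monomial of `F` each variable `X i` has exponent `0` or at least `k i`. -/
def SupportedAbove {R : Type*} [CommRing R] (k : ι → ℕ) (F : MvPowerSeries ι R) : Prop :=
  ∀ d, coeff d F ≠ 0 → ∀ i, d i = 0 ∨ k i ≤ d i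

/-- The exponent that is `k i` for `i ∈ I` and `0` for `i ∉ I`. -/
noncomputable def restrictExponent (k : ι → ℕ) (I : Finset ι) : ι →₀ ℕ :=
  Finsupp.indicator I fun i _ => k i

/-- The Euler derivation `X i * ∂ / ∂ X i` of multivariate power series. -/
def eulerDerivative {R : Type*} [CommRing R] (i : ι) (F : MvPowerSeries ι R) :
    MvPowerSeries ι R :=
  fun d => (d i : R) * coeff d F

/-- The logarithmic Euler derivative `(X i * ∂ F / ∂ X i) / F`. -/
noncomputable def eulerLogDerivative {𝕜 : Type*} [Field 𝕜] (i : ι) (F : MvPowerSeries ι 𝕜) :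
    MvPowerSeries ι 𝕜 :=
  eulerDerivative i F * F⁻¹

theorem restrictExponent_apply [DecidableEq ι] (k : ι → ℕ) (I : Finset ι) (i : ι) :
    restrictExponent k I i = if i ∈ I then k i else 0 := by
  rw [restrictExponent, Finsupp.indicator_apply]
  simp

section CommRing

variable {R : Type*} [CommRing R]

theorem coeff_eulerDerivative (i : ι) (F : MvPowerSeries ι R) (d : ι →₀ ℕ) :
    coeff d (eulerDerivative i F) = (d i : R) * coeff d F :=
  rfl

theorem eulerDerivative_mul (i : ι) (F G : MvPowerSeries ι R) :
    eulerDerivative i (F * G) = eulerDerivative i F * G + F * eulerDerivative i G := by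
  classical
  ext d
  rw [map_add, coeff_eulerDerivative, coeff_mul, coeff_mul, coeff_mul, mul_sum, ← sum_add_distrib]
  refine sum_congr rfl fun p hp => ?_
  rw [← HasAntidiagonal.mem_antidiagonal.1 hp, coeff_eulerDerivative, coeff_eulerDerivative, Finsupp.add_apply]
  push_cast
  ring

theorem eulerDerivative_one (i : ι) : eulerDerivative i (1 : MvPowerSeries ι R) = 0 := by
  classical
  ext d
  rw [coeff_eulerDerivative, coeff_one]
  split_ifs with h
  · simp [h]
  · simp

theorem SupportedAbove.eulerDerivative {k : ι → ℕ} {F : MvPowerSeries ι R}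
    (hF : SupportedAbove k F) (i : ι) : SupportedAbove k (eulerDerivative i F) := by
  intro d hd
  refine hF d fun h => hd ?_
  rw [coeff_eulerDerivative, h, mul_zero]

theorem SupportedAbove.mul {k : ι → ℕ} {F G : MvPowerSeries ι R}
    (hF : SupportedAbove k F) (hG : SupportedAbove k G) : SupportedAbove k (F * G) := by
  classical
  intro d hd i
  rw [coeff_mul] at hd
  obtain ⟨p, hp, hne⟩ := exists_ne_zero_of_sum_ne_zero hd
  have h1 := hF p.1 (left_ne_zero_of_mul hne) i
  have h2 := hG p.2 (right_ne_zero_of_mul hne) i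
  rw [← HasAntidiagonal.mem_antidiagonal.1 hp, Finsupp.add_apply]
  omega

/-- Extracting the coefficients at the exponents `restrictExponent k I` turns products into
convolutions over disjoint unions. -/
theorem coeff_restrictExponent_mul [DecidableEq ι] {k : ι → ℕ} (hk : ∀ i, 0 < k i)
    {F G : MvPowerSeries ι R} (hF : SupportedAbove k F) (hG : SupportedAbove k G) (I : Finset ι) :
    coeff (restrictExponent k I) (F * G) = ∑ J ∈ I.powerset,
      coeff (restrictExponent k J) F * coeff (restrictExponent k (I \ J)) G := by
  rw [coeff_mul]
  symm
  -- For `i ∈ I` two exponents, each `0` or at least `k i > 0`, add up to `k i`; hence exactly one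
  -- of them is `k i` and the other `0`.
  refine sum_of_injOn (fun J => (restrictExponent k J, restrictExponent k (I \ J))) ?_ ?_ ?_ ?_
  · intro J _ J' _ h
    ext i
    have := DFunLike.congr_fun (Prod.ext_iff.1 h).1 i
    simp only [restrictExponent_apply] at this
    have := hk i
    grind
  · intro J hJ
    rw [mem_coe, mem_powerset] at hJ
    rw [mem_coe, HasAntidiagonal.mem_antidiagonal]
    ext i
    simp only [Finsupp.add_apply, restrictExponent_apply, mem_sdiff]
    grind
  · intro p hp hpn
    by_contra hne
    have h1 := hF p.1 (left_ne_zero_of_mul hne)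
    have h2 := hG p.2 (right_ne_zero_of_mul hne)
    have h3 : ∀ i, p.1 i + p.2 i = if i ∈ I then k i else 0 := fun i => by
      rw [← restrictExponent_apply, ← HasAntidiagonal.mem_antidiagonal.1 hp, Finsupp.add_apply]
    refine hpn ⟨I.filter fun i => p.1 i ≠ 0, mem_coe.2 (mem_powerset.2 (filter_subset _ _)), Prod.ext ?_ ?_⟩ <;> ext i <;>
      simp only [restrictExponent_apply, mem_filter, mem_sdiff] <;>
      have := h1 i <;> have := h2 i <;> have := h3 i <;> have := hk i <;> grind
  · intro J _
    rfl

end CommRing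

section Field

variable {𝕜 : Type*} [Field 𝕜]

theorem SupportedAbove.inv {k : ι → ℕ} {F : MvPowerSeries ι 𝕜} (hF : SupportedAbove k F) :
    SupportedAbove k F⁻¹ := by
  classical
  intro d
  induction d using WellFoundedLT.induction with
  | ind d ih =>
  intro hd i
  rw [coeff_inv] at hd
  split_ifs at hd with h0
  · simp [h0]
  · obtain ⟨p, hp, hne⟩ := exists_ne_zero_of_sum_ne_zero (right_ne_zero_of_mul hd)
    split_ifs at hne with hlt
    · have h1 := hF p.1 (left_ne_zero_of_mul hne) i
      have h2 := ih p.2 hlt (right_ne_zero_of_mul hne) i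
      rw [← HasAntidiagonal.mem_antidiagonal.1 hp, Finsupp.add_apply]
      omega
    · exact absurd rfl hne

theorem SupportedAbove.eulerLogDerivative {k : ι → ℕ} {F : MvPowerSeries ι 𝕜}
    (hF : SupportedAbove k F) (i : ι) : SupportedAbove k (eulerLogDerivative i F) :=
  (hF.eulerDerivative i).mul hF.inv

theorem eulerLogDerivative_mul (i : ι) {F G : MvPowerSeries ι 𝕜} (hF : constantCoeff F ≠ 0)
    (hG : constantCoeff G ≠ 0) :
    eulerLogDerivative i (F * G) = eulerLogDerivative i F + eulerLogDerivative i G := by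
  have h1 := MvPowerSeries.mul_inv_cancel F hF
  have h2 := MvPowerSeries.mul_inv_cancel G hG
  simp only [eulerLogDerivative, eulerDerivative_mul, MvPowerSeries.mul_inv_rev]
  linear_combination (eulerDerivative i F * F⁻¹) * h2 + (eulerDerivative i G * G⁻¹) * h1

theorem eulerLogDerivative_prod (i : ι) {κ : Type*} (s : Finset κ) (F : κ → MvPowerSeries ι 𝕜)
    (hF : ∀ j ∈ s, constantCoeff (F j) ≠ 0) :
    eulerLogDerivative i (∏ j ∈ s, F j) = ∑ j ∈ s, eulerLogDerivative i (F j) := by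
  classical
  induction s using Finset.induction_on with
  | empty => simp [eulerLogDerivative, eulerDerivative_one]
  | insert a s ha ih =>
    rw [prod_insert ha, sum_insert ha, eulerLogDerivative_mul, ih]
    · exact fun j hj => hF j (mem_insert_of_mem hj)
    · exact hF a (mem_insert_self a s)
    · rw [map_prod]
      exact prod_ne_zero_iff.2 fun j hj => hF j (mem_insert_of_mem hj)

/-- If the coefficients of `F` at the exponents `restrictExponent k I` are those of the independence
series of a connected graph, then the logarithmic derivative of `F` involves the monomial with
exponent `k`. -/
theorem coeff_eulerLogDerivative_ne_zero [Fintype ι] [DecidableEq ι] {k : ι → ℕ}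
    (hk : ∀ i, 0 < k i) {F : MvPowerSeries ι ℂ} (hF : SupportedAbove k F) (G : SimpleGraph ι)
    (hFG : ∀ I, coeff (restrictExponent k I) F = indepSign ℂ G I)
    (hG : ∀ K : Finset ι, K.Nonempty → K ≠ univ → ∃ a ∈ K, ∃ b ∉ K, G.Adj a b) (i : ι) :
    coeff (restrictExponent k univ) (eulerLogDerivative i F) ≠ 0 := by
  -- The partial order on `ℂ` lets the sign argument run on complex coefficients directly.
  open scoped ComplexOrder in
  have h0 : ∀ I, restrictExponent k I = 0 ↔ I = ∅ := by
    intro I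
    simp only [Finsupp.ext_iff, restrictExponent_apply, Finsupp.coe_zero, Pi.zero_apply,
      eq_empty_iff_forall_notMem]
    have := fun i => (hk i).ne'
    grind
  have hF0 : constantCoeff F ≠ 0 := by
    rw [← coeff_zero_eq_constantCoeff_apply, ← (h0 ∅).2 rfl, hFG]
    simp [indepSign]
  have hinv : ∀ I, ∑ J ∈ I.powerset,
      indepSign ℂ G J * coeff (restrictExponent k (I \ J)) F⁻¹ = if I = ∅ then 1 else 0 := by
    intro I
    have h1 := coeff_restrictExponent_mul hk hF hF.inv I
    rw [MvPowerSeries.mul_inv_cancel F hF0, coeff_one] at h1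
    simp only [h0, hFG] at h1
    exact h1.symm
  have h1 := sum_indepSign_mem_mul_neg G (fun I => coeff (restrictExponent k I) F⁻¹)
    (by convert hinv) hG i
  rw [eulerLogDerivative, coeff_restrictExponent_mul hk (hF.eulerDerivative i) hF.inv]
  have h2 : ∑ J ∈ (univ : Finset ι).powerset, coeff (restrictExponent k J) (eulerDerivative i F) *
      coeff (restrictExponent k (univ \ J)) F⁻¹ = k i * ∑ J ∈ (univ : Finset ι).powerset,
      (if i ∈ J then indepSign ℂ G J else 0) * coeff (restrictExponent k (univ \ J)) F⁻¹ := by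
    rw [mul_sum]
    refine sum_congr rfl fun J _ => ?_
    rw [coeff_eulerDerivative, hFG, restrictExponent_apply]
    split_ifs <;> push_cast <;> ring
  rw [h2]
  refine mul_ne_zero (Nat.cast_ne_zero.2 (hk i).ne') ?_
  convert h1.ne

end Field

end PowerSeries

/-! ### Words, length and descents in the Weyl group. -/

namespace CartanRealization

open Module

variable {ι : Type*} [Fintype ι] {A : Matrix ι ι ℤ} {H : Type*} [AddCommGroup H] [Module ℂ H]
  (R : CartanRealization A H) (hA : IsGeneralizedCartanMatrix A)

/-- The product of the simple reflections that correspond to the letters of a word. -/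
noncomputable def wordProd (l : List ι) : Dual ℂ H ≃ₗ[ℂ] Dual ℂ H :=
  (l.map (R.simpleReflection hA)).prod

@[simp]
theorem wordProd_nil : R.wordProd hA [] = 1 := rfl

@[simp]
theorem wordProd_append (l l' : List ι) :
    R.wordProd hA (l ++ l') = R.wordProd hA l * R.wordProd hA l' := by
  simp [wordProd]

theorem wordProd_cons (i : ι) (l : List ι) :
    R.wordProd hA (i :: l) = R.simpleReflection hA i * R.wordProd hA l := by
  simp [wordProd]

@[simp]
theorem wordProd_singleton (i : ι) : R.wordProd hA [i] = R.simpleReflection hA i := by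
  simp [wordProd]

theorem simpleReflection_mul_self (i : ι) :
    R.simpleReflection hA i * R.simpleReflection hA i = 1 := by
  refine LinearEquiv.ext fun ν => ?_
  simp only [LinearEquiv.mul_apply, simpleReflection_apply, LinearEquiv.coe_one, id_eq,
    LinearMap.sub_apply, LinearMap.smul_apply, R.root_coroot, hA.diag, smul_eq_mul]
  push_cast
  module

theorem mul_simpleReflection_mul_self (w : Dual ℂ H ≃ₗ[ℂ] Dual ℂ H) (i : ι) :
    w * R.simpleReflection hA i * R.simpleReflection hA i = w := by
  rw [mul_assoc, simpleReflection_mul_self, mul_one]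

theorem simpleReflection_mem_weylGroup (i : ι) : R.simpleReflection hA i ∈ R.weylGroup hA :=
  Subgroup.subset_closure ⟨i, rfl⟩

theorem wordProd_mem_weylGroup (l : List ι) : R.wordProd hA l ∈ R.weylGroup hA := by
  induction l with
  | nil => exact one_mem _
  | cons i l ih =>
    rw [wordProd_cons]
    exact mul_mem (R.simpleReflection_mem_weylGroup hA i) ih

theorem exists_wordProd_eq {w : Dual ℂ H ≃ₗ[ℂ] Dual ℂ H} (hw : w ∈ R.weylGroup hA) :
    ∃ l, R.wordProd hA l = w := by
  induction hw using Subgroup.closure_induction with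
  | mem x hx =>
    obtain ⟨i, rfl⟩ := hx
    exact ⟨[i], wordProd_singleton ..⟩
  | one => exact ⟨[], rfl⟩
  | mul x y _ _ hx hy =>
    obtain ⟨l, rfl⟩ := hx
    obtain ⟨l', rfl⟩ := hy
    exact ⟨l ++ l', wordProd_append ..⟩
  | inv x _ hx =>
    obtain ⟨l, rfl⟩ := hx
    refine ⟨l.reverse, eq_inv_of_mul_eq_one_left ?_⟩
    clear * -
    induction l with
    | nil => rfl
    | cons i l ih =>
      rw [List.reverse_cons, wordProd_append, wordProd_singleton, wordProd_cons, mul_assoc,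
        ← mul_assoc (R.simpleReflection hA i), simpleReflection_mul_self, one_mul, ih]

/-- The length of an element of the Weyl group with respect to the simple reflections. -/
noncomputable def length (w : Dual ℂ H ≃ₗ[ℂ] Dual ℂ H) : ℕ :=
  sInf {n | ∃ l : List ι, l.length = n ∧ R.wordProd hA l = w}

theorem length_wordProd_le (l : List ι) : R.length hA (R.wordProd hA l) ≤ l.length :=
  Nat.sInf_le ⟨l, rfl, rfl⟩

theorem exists_reduced_word {w : Dual ℂ H ≃ₗ[ℂ] Dual ℂ H} (hw : w ∈ R.weylGroup hA) :
    ∃ l, R.wordProd hA l = w ∧ l.length = R.length hA w := by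
  obtain ⟨l, hl⟩ := R.exists_wordProd_eq hA hw
  obtain ⟨l', h1, h2⟩ := Nat.sInf_mem (s := {n | ∃ l : List ι, l.length = n ∧
    R.wordProd hA l = w}) ⟨_, l, rfl, hl⟩
  exact ⟨l', h2, h1⟩

theorem length_mul_wordProd_le {w : Dual ℂ H ≃ₗ[ℂ] Dual ℂ H} (hw : w ∈ R.weylGroup hA)
    (l : List ι) : R.length hA (w * R.wordProd hA l) ≤ R.length hA w + l.length := by
  obtain ⟨l', rfl, h⟩ := R.exists_reduced_word hA hw
  rw [← wordProd_append, ← h, ← List.length_append]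
  exact R.length_wordProd_le hA _

theorem length_mul_simpleReflection_le {w : Dual ℂ H ≃ₗ[ℂ] Dual ℂ H} (hw : w ∈ R.weylGroup hA)
    (i : ι) : R.length hA (w * R.simpleReflection hA i) ≤ R.length hA w + 1 := by
  simpa using R.length_mul_wordProd_le hA hw [i]

theorem det_wordProd (l : List ι) : LinearEquiv.det (R.wordProd hA l) = (-1) ^ l.length := by
  induction l with
  | nil => simp
  | cons i l ih =>
    have := R.sign_simpleReflection hA i
    simp only [sign, MonoidHom.comp_apply, Subgroup.subtype_apply] at this
    rw [wordProd_cons, map_mul, ih, this, List.length_cons, pow_succ']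

/-- The determinant fixes the parity of the length, and a reflection changes it. -/
theorem length_mul_simpleReflection_ne {w : Dual ℂ H ≃ₗ[ℂ] Dual ℂ H} (hw : w ∈ R.weylGroup hA)
    (i : ι) : R.length hA (w * R.simpleReflection hA i) ≠ R.length hA w := by
  intro h
  obtain ⟨l, h1, h2⟩ := R.exists_reduced_word hA hw
  obtain ⟨l', h3, h4⟩ := R.exists_reduced_word hA
    (mul_mem hw (R.simpleReflection_mem_weylGroup hA i))
  have h5 := congrArg LinearEquiv.det h3
  rw [← h1, ← wordProd_singleton, ← wordProd_append, det_wordProd, det_wordProd, h4, h, ← h2,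
    List.length_append, pow_add] at h5
  simp at h5

/-- A descent of `w` at `t` splits off a maximal alternating word in `s` and `t`. -/
theorem exists_eq_mul_alternatingWord (n : ℕ) : ∀ (w : Dual ℂ H ≃ₗ[ℂ] Dual ℂ H)
    (_ : w ∈ R.weylGroup hA) (_ : R.length hA w = n) (s t : ι)
    (_ : R.length hA (w * R.simpleReflection hA t) < R.length hA w),
    ∃ v ∈ R.weylGroup hA, ∃ r : ℕ, 0 < r ∧
      w = v * R.wordProd hA (CoxeterSystem.alternatingWord s t r) ∧
      R.length hA w = R.length hA v + r ∧
      R.length hA v < R.length hA (v * R.simpleReflection hA s) ∧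
      R.length hA v < R.length hA (v * R.simpleReflection hA t) := by
  induction n with
  | zero => intro w _ h0 s t hlt; omega
  | succ n ih =>
    intro w hw hn s t hlt
    have hw1 := mul_mem hw (R.simpleReflection_mem_weylGroup hA t)
    have h1 := R.length_mul_simpleReflection_le hA hw1 t
    rw [mul_simpleReflection_mul_self] at h1
    have h2 := R.length_mul_simpleReflection_ne hA hw1 s
    -- If `s` is a descent of `w t`, recurse with `s` and `t` exchanged; otherwise `w t` has no
    -- descent in `{s, t}` and serves as `v`.
    by_cases h3 : R.length hA (w * R.simpleReflection hA t * R.simpleReflection hA s) <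
        R.length hA (w * R.simpleReflection hA t)
    · obtain ⟨v, hv, r, hr, e1, e2, e3, e4⟩ := ih _ hw1 (by omega) t s h3
      refine ⟨v, hv, r + 1, by omega, ?_, by omega, e4, e3⟩
      rw [CoxeterSystem.alternatingWord_succ, List.concat_eq_append, wordProd_append,
        ← mul_assoc, ← e1, wordProd_singleton, mul_simpleReflection_mul_self]
    · refine ⟨_, hw1, 1, one_pos, ?_, by omega, by omega, ?_⟩
      · simp [CoxeterSystem.alternatingWord, mul_simpleReflection_mul_self]
      · rw [mul_simpleReflection_mul_self]; exact hlt

/-! ### Rank two: alternating words acting on the two roots. -/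

section RankTwo

variable (s t : ι)

theorem simpleReflection_left_apply (ν : Dual ℂ H) (P Q : ℂ) :
    R.simpleReflection hA s (ν + P • R.root s + Q • R.root t) =
      ν + (-P - ν (R.coroot s) - Q * A s t) • R.root s + Q • R.root t := by
  simp only [simpleReflection_apply, LinearMap.add_apply, LinearMap.smul_apply, R.root_coroot,
    hA.diag, smul_eq_mul]
  push_cast
  module

theorem simpleReflection_right_apply (ν : Dual ℂ H) (P Q : ℂ) :
    R.simpleReflection hA t (ν + P • R.root s + Q • R.root t) =
      ν + P • R.root s + (-Q - ν (R.coroot t) - P * A t s) • R.root t := by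
  simp only [simpleReflection_apply, LinearMap.add_apply, LinearMap.smul_apply, R.root_coroot,
    hA.diag, smul_eq_mul]
  push_cast
  module

variable {s t}

/-- The infinite dihedral case. The cone `a * q ≤ 2 * p` is an invariant: reflecting in `t` replaces
`q` by `b * p - q`, and `4 ≤ a * b` yields the same inequality with the roles of `s` and `t`
exchanged. -/
theorem alternatingWord_apply_of_four_le {a b : ℕ} (ha : A s t = -a) (hb : A t s = -b)
    (hab : 4 ≤ a * b) (r : ℕ) : ∀ p q : ℕ, a * q ≤ 2 * p → ∃ p' q' : ℕ,
      R.wordProd hA (CoxeterSystem.alternatingWord s t r) (p • R.root s + q • R.root t) =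
        p' • R.root s + q' • R.root t := by
  induction r generalizing s t a b with
  | zero => exact fun p q _ => ⟨p, q, rfl⟩
  | succ r ih =>
    intro p q hpq
    have h1 : 2 * q ≤ b * p := by nlinarith
    obtain ⟨p', q', h⟩ := ih hb ha (by rwa [mul_comm]) (b * p - q) p (by omega)
    refine ⟨q', p', ?_⟩
    have h2 : R.simpleReflection hA t (p • R.root s + q • R.root t) =
        (b * p - q) • R.root t + p • R.root s := by
      have h3 := R.simpleReflection_right_apply hA s t 0 p q
      simp only [zero_add, Nat.cast_smul_eq_nsmul, LinearMap.zero_apply, hb] at h3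
      rw [h3, add_comm, ← Nat.cast_smul_eq_nsmul ℂ (b * p - q), Nat.cast_sub (by omega)]
      congr 2
      push_cast
      ring
    rw [CoxeterSystem.alternatingWord_succ, List.concat_eq_append, wordProd_append,
      LinearEquiv.mul_apply, wordProd_singleton, h2, h, add_comm]

theorem wordProd_alternatingWord_succ (r : ℕ) :
    R.wordProd hA (CoxeterSystem.alternatingWord s t (r + 1)) =
      R.wordProd hA (CoxeterSystem.alternatingWord t s r) * R.simpleReflection hA t := by
  rw [CoxeterSystem.alternatingWord_succ, List.concat_eq_append, wordProd_append,
    wordProd_singleton]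

/-- This and the next three are the braid relations of order `m = 2, 3, 4, 6`, in the form that
shortens an alternating word of `m + 1` letters to `m - 1` letters. -/
theorem simpleReflection_braid_two (hx : A s t = 0) (hy : A t s = 0) :
    R.simpleReflection hA s * R.simpleReflection hA t * R.simpleReflection hA s =
      R.simpleReflection hA t := by
  refine LinearEquiv.ext fun ν => ?_
  rw [show ν = ν + (0 : ℂ) • R.root s + (0 : ℂ) • R.root t by simp]
  simp only [LinearEquiv.mul_apply, simpleReflection_left_apply, simpleReflection_right_apply,
    hx, hy]
  push_cast
  module

theorem simpleReflection_braid_three (hx : A s t = -1) (hy : A t s = -1) :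
    R.simpleReflection hA t * R.simpleReflection hA s * R.simpleReflection hA t *
      R.simpleReflection hA s = R.simpleReflection hA s * R.simpleReflection hA t := by
  refine LinearEquiv.ext fun ν => ?_
  rw [show ν = ν + (0 : ℂ) • R.root s + (0 : ℂ) • R.root t by simp]
  simp only [LinearEquiv.mul_apply, simpleReflection_left_apply, simpleReflection_right_apply,
    hx, hy]
  push_cast
  module

theorem simpleReflection_braid_four {a b : ℕ} (hx : A s t = -a) (hy : A t s = -b)
    (hab : a = 1 ∧ b = 2 ∨ a = 2 ∧ b = 1) :
    R.simpleReflection hA s * R.simpleReflection hA t * R.simpleReflection hA s *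
      R.simpleReflection hA t * R.simpleReflection hA s =
      R.simpleReflection hA t * R.simpleReflection hA s * R.simpleReflection hA t := by
  refine LinearEquiv.ext fun ν => ?_
  rw [show ν = ν + (0 : ℂ) • R.root s + (0 : ℂ) • R.root t by simp]
  simp only [LinearEquiv.mul_apply, simpleReflection_left_apply, simpleReflection_right_apply,
    hx, hy]
  rcases hab with ⟨rfl, rfl⟩ | ⟨rfl, rfl⟩ <;> push_cast <;> module

theorem simpleReflection_braid_six {a b : ℕ} (hx : A s t = -a) (hy : A t s = -b)
    (hab : a = 1 ∧ b = 3 ∨ a = 3 ∧ b = 1) :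
    R.simpleReflection hA s * R.simpleReflection hA t * R.simpleReflection hA s *
      R.simpleReflection hA t * R.simpleReflection hA s * R.simpleReflection hA t *
      R.simpleReflection hA s =
      R.simpleReflection hA t * R.simpleReflection hA s * R.simpleReflection hA t *
      R.simpleReflection hA s * R.simpleReflection hA t := by
  refine LinearEquiv.ext fun ν => ?_
  rw [show ν = ν + (0 : ℂ) • R.root s + (0 : ℂ) • R.root t by simp]
  simp only [LinearEquiv.mul_apply, simpleReflection_left_apply, simpleReflection_right_apply,
    hx, hy]
  rcases hab with ⟨rfl, rfl⟩ | ⟨rfl, rfl⟩ <;> push_cast <;> module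

/-- An alternating word in `s` and `t` that ends in `t` maps the root of `s` to a nonnegative
combination of the two roots, or becomes shorter when multiplied by `s`. -/
theorem alternatingWord_apply_root (hst : s ≠ t) (r : ℕ) :
    (∃ p q : ℕ, R.wordProd hA (CoxeterSystem.alternatingWord s t r) (R.root s) =
        p • R.root s + q • R.root t) ∨
    ∃ l : List ι, l.length < r ∧ R.wordProd hA (CoxeterSystem.alternatingWord s t r) *
        R.simpleReflection hA s = R.wordProd hA l := by
  obtain ⟨a, ha⟩ := Int.exists_eq_neg_ofNat (hA.nonpos s t hst)
  obtain ⟨b, hb⟩ := Int.exists_eq_neg_ofNat (hA.nonpos t s hst.symm)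
  have hs' : ∀ w : Dual ℂ H ≃ₗ[ℂ] Dual ℂ H, w (R.root s) =
      w ((0 : Dual ℂ H) + (1 : ℂ) • R.root s + (0 : ℂ) • R.root t) := by simp
  have h0 : ∀ (u w : ι) (n : ℕ), (CoxeterSystem.alternatingWord u w n).length = n :=
    CoxeterSystem.length_alternatingWord
  by_cases hab : 4 ≤ a * b
  · obtain ⟨p, q, h⟩ := R.alternatingWord_apply_of_four_le hA ha hb hab r 1 0 (by simp)
    exact Or.inl ⟨p, q, by simpa using h⟩
  have hz : a = 0 ↔ b = 0 := by
    constructor <;> rintro rfl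
    · have := hA.zero_symm s t (by simpa using ha)
      omega
    · have := hA.zero_symm t s (by simpa using hb)
      omega
  have hcases : (a = 0 ∧ b = 0) ∨ (a = 1 ∧ b = 1) ∨ (a = 1 ∧ b = 2 ∨ a = 2 ∧ b = 1) ∨
      (a = 1 ∧ b = 3 ∨ a = 3 ∧ b = 1) := by
    by_cases ha0 : a = 0
    · exact Or.inl ⟨ha0, hz.1 ha0⟩
    have hb0 : b ≠ 0 := fun h => ha0 (hz.2 h)
    have : a ≤ 3 := by nlinarith [Nat.pos_of_ne_zero hb0]
    have : b ≤ 3 := by nlinarith [Nat.pos_of_ne_zero ha0]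
    interval_cases a <;> interval_cases b <;> omega
  have hconcat : ∀ (l : List ι) (i : ι), R.wordProd hA l * R.simpleReflection hA i =
      R.wordProd hA (l ++ [i]) := fun l i => by simp
  -- In the finite case of order `m`, the image of the root is computed for each `r < m`; for `r ≥
  -- m` the braid relation shortens the product.
  rcases hcases with ⟨rfl, rfl⟩ | ⟨rfl, rfl⟩ | h4 | h6
  · rcases r with _ | _ | r
    · exact Or.inl ⟨1, 0, by simp [CoxeterSystem.alternatingWord]⟩
    · refine Or.inl ⟨1, 0, ?_⟩
      rw [hs']
      simp only [CoxeterSystem.alternatingWord, List.concat, wordProd_cons, wordProd_nil, mul_one,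
        simpleReflection_right_apply, hb, LinearMap.zero_apply]
      push_cast
      module
    · refine Or.inr ⟨CoxeterSystem.alternatingWord s t r ++ [t], by simp [h0], ?_⟩
      have := R.simpleReflection_braid_two hA (by simpa using ha) (by simpa using hb)
      rw [← hconcat, ← this]
      simp only [wordProd_alternatingWord_succ, mul_assoc]
  · rcases r with _ | _ | _ | r
    · exact Or.inl ⟨1, 0, by simp [CoxeterSystem.alternatingWord]⟩
    · refine Or.inl ⟨1, 1, ?_⟩
      rw [hs']
      simp only [CoxeterSystem.alternatingWord, List.concat, wordProd_cons, wordProd_nil, mul_one,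
        simpleReflection_right_apply, hb, LinearMap.zero_apply]
      push_cast
      module
    · refine Or.inl ⟨0, 1, ?_⟩
      rw [hs']
      simp only [CoxeterSystem.alternatingWord, List.concat, wordProd_cons, wordProd_nil, mul_one,
        LinearEquiv.mul_apply, simpleReflection_left_apply, simpleReflection_right_apply, ha, hb,
        LinearMap.zero_apply]
      push_cast
      module
    · refine Or.inr ⟨CoxeterSystem.alternatingWord t s r ++ [s] ++ [t], by simp [h0], ?_⟩
      have := R.simpleReflection_braid_three hA (by simpa using ha) (by simpa using hb)
      simp only [← hconcat, wordProd_alternatingWord_succ]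
      simp only [mul_assoc] at this ⊢
      rw [this]
  · rcases r with _ | _ | _ | _ | r
    · exact Or.inl ⟨1, 0, by simp [CoxeterSystem.alternatingWord]⟩
    · refine Or.inl ⟨1, b, ?_⟩
      rw [hs']
      simp only [CoxeterSystem.alternatingWord, List.concat, wordProd_cons, wordProd_nil, mul_one,
        simpleReflection_right_apply, hb, LinearMap.zero_apply]
      push_cast
      module
    · refine Or.inl ⟨1, b, ?_⟩
      rw [hs']
      simp only [CoxeterSystem.alternatingWord, List.concat, wordProd_cons, wordProd_nil, mul_one,
        LinearEquiv.mul_apply, simpleReflection_left_apply, simpleReflection_right_apply, ha, hb,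
        LinearMap.zero_apply]
      rcases h4 with ⟨rfl, rfl⟩ | ⟨rfl, rfl⟩ <;> push_cast <;> module
    · refine Or.inl ⟨1, 0, ?_⟩
      rw [hs']
      simp only [CoxeterSystem.alternatingWord, List.concat, wordProd_cons, wordProd_nil, mul_one,
        LinearEquiv.mul_apply, simpleReflection_left_apply, simpleReflection_right_apply, ha, hb,
        LinearMap.zero_apply]
      rcases h4 with ⟨rfl, rfl⟩ | ⟨rfl, rfl⟩ <;> push_cast <;> module
    · refine Or.inr ⟨CoxeterSystem.alternatingWord s t r ++ [t] ++ [s] ++ [t], by simp [h0], ?_⟩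
      have := R.simpleReflection_braid_four hA ha hb h4
      simp only [← hconcat, wordProd_alternatingWord_succ]
      simp only [mul_assoc] at this ⊢
      rw [this]
  · rcases r with _ | _ | _ | _ | _ | _ | r
    · exact Or.inl ⟨1, 0, by simp [CoxeterSystem.alternatingWord]⟩
    · refine Or.inl ⟨1, b, ?_⟩
      rw [hs']
      simp only [CoxeterSystem.alternatingWord, List.concat, wordProd_cons, wordProd_nil, mul_one,
        simpleReflection_right_apply, hb, LinearMap.zero_apply]
      push_cast
      module
    · refine Or.inl ⟨2, b, ?_⟩
      rw [hs']
      simp only [CoxeterSystem.alternatingWord, List.concat, wordProd_cons, wordProd_nil, mul_one,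
        LinearEquiv.mul_apply, simpleReflection_left_apply, simpleReflection_right_apply, ha, hb,
        LinearMap.zero_apply]
      rcases h6 with ⟨rfl, rfl⟩ | ⟨rfl, rfl⟩ <;> push_cast <;> module
    · refine Or.inl ⟨2, b, ?_⟩
      rw [hs']
      simp only [CoxeterSystem.alternatingWord, List.concat, wordProd_cons, wordProd_nil, mul_one,
        LinearEquiv.mul_apply, simpleReflection_left_apply, simpleReflection_right_apply, ha, hb,
        LinearMap.zero_apply]
      rcases h6 with ⟨rfl, rfl⟩ | ⟨rfl, rfl⟩ <;> push_cast <;> module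
    · refine Or.inl ⟨1, b, ?_⟩
      rw [hs']
      simp only [CoxeterSystem.alternatingWord, List.concat, wordProd_cons, wordProd_nil, mul_one,
        LinearEquiv.mul_apply, simpleReflection_left_apply, simpleReflection_right_apply, ha, hb,
        LinearMap.zero_apply]
      rcases h6 with ⟨rfl, rfl⟩ | ⟨rfl, rfl⟩ <;> push_cast <;> module
    · refine Or.inl ⟨1, 0, ?_⟩
      rw [hs']
      simp only [CoxeterSystem.alternatingWord, List.concat, wordProd_cons, wordProd_nil, mul_one,
        LinearEquiv.mul_apply, simpleReflection_left_apply, simpleReflection_right_apply, ha, hb,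
        LinearMap.zero_apply]
      rcases h6 with ⟨rfl, rfl⟩ | ⟨rfl, rfl⟩ <;> push_cast <;> module
    · refine Or.inr ⟨CoxeterSystem.alternatingWord s t r ++ [t] ++ [s] ++ [t] ++ [s] ++ [t],
        by simp [h0], ?_⟩
      have := R.simpleReflection_braid_six hA ha hb h6
      simp only [← hconcat, wordProd_alternatingWord_succ]
      simp only [mul_assoc] at this ⊢
      rw [this]

end RankTwo

/-- Factor `w = v u` with `u` alternating in `i` and a descent `t` of `w`, and `v` without descents
in `{i, t}`. Then `u` keeps the root of `i` in the cone of the two roots, which the shorter `v`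
sends to positive combinations by induction. -/
theorem apply_root_mem_closure (n : ℕ) : ∀ (w : Dual ℂ H ≃ₗ[ℂ] Dual ℂ H)
    (_ : w ∈ R.weylGroup hA) (_ : R.length hA w = n) (i : ι)
    (_ : R.length hA w ≤ R.length hA (w * R.simpleReflection hA i)),
    w (R.root i) ∈ AddSubmonoid.closure (Set.range R.root) := by
  induction n using Nat.strong_induction_on with
  | _ n ih =>
  intro w hw hn i hi
  obtain ⟨l, rfl, hl⟩ := R.exists_reduced_word hA hw
  rcases List.eq_nil_or_concat l with rfl | ⟨l', t, rfl⟩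
  · exact AddSubmonoid.subset_closure ⟨i, rfl⟩
  rw [List.concat_eq_append] at *
  have hlt : R.length hA (R.wordProd hA (l' ++ [t]) * R.simpleReflection hA t) <
      R.length hA (R.wordProd hA (l' ++ [t])) := by
    rw [← hl, wordProd_append, wordProd_singleton, mul_simpleReflection_mul_self,
      List.length_append, List.length_singleton]
    exact Nat.lt_succ_of_le (R.length_wordProd_le hA l')
  have hit : i ≠ t := by rintro rfl; omega
  obtain ⟨v, hv, r, hr, e1, e2, e3, e4⟩ := R.exists_eq_mul_alternatingWord hA n _ hw hn i t hlt
  rw [e1]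
  rcases R.alternatingWord_apply_root hA hit r with ⟨p, q, h⟩ | ⟨l, hlr, h⟩
  · rw [LinearEquiv.mul_apply, h, map_add, map_nsmul, map_nsmul]
    exact add_mem (nsmul_mem (ih _ (by omega) v hv rfl i e3.le) p)
      (nsmul_mem (ih _ (by omega) v hv rfl t e4.le) q)
  · exfalso
    rw [e1, mul_assoc, h, ← e1] at hi
    have := R.length_mul_wordProd_le hA hv l
    omega

end CartanRealization

/-! ### Expansion of `Λ - w Λ` and the coefficients of Weyl numerators. -/

namespace CartanRealization

open Module

variable {ι : Type*} [Fintype ι] {A : Matrix ι ι ℤ} {H : Type*} [AddCommGroup H] [Module ℂ H]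
  (R : CartanRealization A H) (hA : IsGeneralizedCartanMatrix A)

theorem eq_of_sum_smul_root_eq {a b : ι → ℂ} (h : ∑ i, a i • R.root i = ∑ i, b i • R.root i) :
    a = b := by
  have h1 := Fintype.linearIndependent_iff.1 R.root_linearIndependent (a - b) (by
    simp [sub_smul, h])
  exact funext fun i => sub_eq_zero.1 (h1 i)

theorem sum_nsmul_root (c : ι → ℕ) :
    ∑ i, c i • R.root i = ∑ i, (c i : ℂ) • R.root i := by
  simp only [Nat.cast_smul_eq_nsmul]

theorem eq_of_sum_nsmul_root_eq {a b : ι → ℕ} (h : ∑ i, a i • R.root i = ∑ i, b i • R.root i) :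
    a = b := by
  rw [sum_nsmul_root, sum_nsmul_root] at h
  exact funext fun i => by exact_mod_cast congrFun (R.eq_of_sum_smul_root_eq h) i

theorem exists_nsmul_of_mem_closure {β : Dual ℂ H}
    (h : β ∈ AddSubmonoid.closure (Set.range R.root)) : ∃ b : ι → ℕ, β = ∑ i, b i • R.root i := by
  classical
  induction h using AddSubmonoid.closure_induction with
  | mem x hx =>
    obtain ⟨i, rfl⟩ := hx
    exact ⟨Pi.single i 1, by simp [Pi.single_apply]⟩
  | zero => exact ⟨0, by simp⟩
  | add x y _ _ hx hy =>
    obtain ⟨b, rfl⟩ := hx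
    obtain ⟨c, rfl⟩ := hy
    exact ⟨b + c, by simp [add_smul, Finset.sum_add_distrib]⟩

theorem exists_wordProd_apply_eq (l : List ι) (ν : Dual ℂ H) :
    ∃ g : ι → ℂ, (∀ j ∉ l, g j = 0) ∧ R.wordProd hA l ν = ν + ∑ j, g j • R.root j := by
  classical
  induction l with
  | nil => exact ⟨0, by simp⟩
  | cons i l ih =>
    obtain ⟨g, hg, h⟩ := ih
    refine ⟨g + Pi.single i (-(R.wordProd hA l ν (R.coroot i))), ?_, ?_⟩
    · intro j hj
      rw [List.mem_cons, not_or] at hj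
      simp [hg j hj.2, hj.1]
    · rw [wordProd_cons, LinearEquiv.mul_apply, simpleReflection_apply, h]
      simp [add_smul, Finset.sum_add_distrib, Pi.single_apply, sub_eq_add_neg, add_assoc]

theorem wordProd_apply_of_pairwise [DecidableEq ι] {l : List ι}
    (hl : l.Pairwise fun i j => A i j = 0) (ν : Dual ℂ H) :
    R.wordProd hA l ν = ν - ∑ j, if j ∈ l then ν (R.coroot j) • R.root j else 0 := by
  induction l with
  | nil => simp
  | cons i l ih =>
    rw [List.pairwise_cons] at hl
    have hil : i ∉ l := fun h => by simpa [hA.diag] using hl.1 i h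
    have h1 : (∑ j, if j ∈ l then ν (R.coroot j) • R.root j else 0) (R.coroot i) = 0 := by
      rw [LinearMap.sum_apply]
      refine Finset.sum_eq_zero fun j _ => ?_
      split_ifs with h
      · simp [R.root_coroot, hl.1 j h]
      · rfl
    have h2 : (∑ j, if j ∈ i :: l then ν (R.coroot j) • R.root j else 0) =
        ν (R.coroot i) • R.root i + ∑ j, if j ∈ l then ν (R.coroot j) • R.root j else 0 := by
      have h3 : ∀ j, (if j ∈ i :: l then ν (R.coroot j) • R.root j else 0) =
          (if j = i then ν (R.coroot j) • R.root j else 0) +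
            if j ∈ l then ν (R.coroot j) • R.root j else 0 := by
        intro j
        by_cases hji : j = i
        · subst hji; simp [hil]
        · simp [hji]
      simp only [h3, Finset.sum_add_distrib, Finset.sum_ite_eq', Finset.mem_univ, if_true]
    rw [wordProd_cons, LinearEquiv.mul_apply, ih hl.2, simpleReflection_apply, LinearMap.sub_apply,
      h1, h2]
    module

/-- The difference `Λ - w Λ` for a regular dominant weight `Λ` and a reduced word of `w`: its
support consists of the letters of the word, its coefficients there are bounded below by those of
`Λ`, and the bounds are attained only for products of commuting reflections. -/
theorem exists_sub_wordProd_apply_eq {Λ : Dual ℂ H} {k : ι → ℕ} (hk : ∀ i, Λ (R.coroot i) = k i)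
    (hk0 : ∀ i, 0 < k i) (l : List ι) (hl : R.length hA (R.wordProd hA l) = l.length) :
    ∃ c : ι → ℕ, Λ - R.wordProd hA l Λ = ∑ i, c i • R.root i ∧ (∀ i ∈ l, k i ≤ c i) ∧
      (∀ i ∉ l, c i = 0) ∧ ((∀ i ∈ l, c i = k i) → l.Pairwise fun i j => A i j = 0) := by
  classical
  induction l using List.reverseRecOn with
  | nil => exact ⟨0, by simp⟩
  | append_singleton l i ih =>
    have hw := R.wordProd_mem_weylGroup hA l
    rw [wordProd_append, wordProd_singleton, List.length_append, List.length_singleton] at hl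
    have h1 := R.length_mul_simpleReflection_le hA hw i
    have h2 := R.length_wordProd_le hA l
    obtain ⟨c, hc, hcl, hcn, hcp⟩ := ih (by omega)
    obtain ⟨b, hb⟩ := R.exists_nsmul_of_mem_closure
      (R.apply_root_mem_closure hA _ _ hw rfl i (by omega))
    obtain ⟨g, hg, hgb⟩ := R.exists_wordProd_apply_eq hA l (R.root i)
    have hbg : ∀ j, (b j : ℂ) = (if j = i then 1 else 0) + g j := by
      have : (fun j => (b j : ℂ)) = fun j => (if j = i then 1 else 0) + g j := by
        refine R.eq_of_sum_smul_root_eq ?_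
        rw [← sum_nsmul_root, ← hb, hgb]
        simp [add_smul, Finset.sum_add_distrib]
      exact congrFun this
    have hbn : ∀ j ∉ l, b j = if j = i then 1 else 0 := by
      intro j hj
      have := hbg j
      rw [hg j hj, add_zero] at this
      exact_mod_cast this
    -- With `w` the product of `l`, `w sᵢ Λ = w Λ - k i • w αᵢ`, and `b` holds the coordinates of `w
    -- αᵢ`, nonnegative because the word is reduced.
    refine ⟨fun j => c j + k i * b j, ?_, ?_, ?_, ?_⟩
    · rw [wordProd_append, wordProd_singleton, LinearEquiv.mul_apply, simpleReflection_apply,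
        map_sub, map_smul, hk, hb, Nat.cast_smul_eq_nsmul, sub_sub_eq_add_sub, add_sub_right_comm,
        hc]
      simp [add_smul, Finset.sum_add_distrib, Finset.smul_sum, mul_smul]
    · intro j hj
      by_cases hjl : j ∈ l
      · exact (hcl j hjl).trans (Nat.le_add_right _ _)
      · have hji : j = i := by simpa [hjl] using hj
        subst hji
        simp [hbn j hjl]
    · intro j hj
      simp only [List.mem_append, List.mem_singleton, not_or] at hj
      simp [hcn j hj.1, hbn j hj.1, hj.2]
    · intro hj
      -- Equality leaves no room for `b` on the letters of `l`. Since `l` is by induction a product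
      -- of commuting reflections, `b` is also explicit in terms of `A j i`, which must therefore
      -- vanish.
      have hcb : ∀ j ∈ l, c j = k j ∧ b j = 0 := by
        intro j hjl
        have h3 : c j + k i * b j = k j := hj j (by simp [hjl])
        have h4 := hcl j hjl
        have h5 : k i * b j = 0 := by omega
        exact ⟨by omega, (mul_eq_zero.1 h5).resolve_left (hk0 i).ne'⟩
      have hp := hcp fun j hjl => (hcb j hjl).1
      have hbA : ∀ j ∈ l, (b j : ℂ) = (if j = i then 1 else 0) - A j i := by
        have h3 := R.wordProd_apply_of_pairwise hA hp (R.root i)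
        have : (fun j => (b j : ℂ)) =
            fun j => (if j = i then 1 else 0) - if j ∈ l then (A j i : ℂ) else 0 := by
          refine R.eq_of_sum_smul_root_eq ?_
          rw [← sum_nsmul_root, ← hb, h3]
          simp [sub_smul, Finset.sum_sub_distrib, R.root_coroot]
        intro j hjl
        simpa [hjl] using congrFun this j
      have hil : i ∉ l := by
        intro hil
        have h3 := hbA i hil
        rw [(hcb i hil).2, hA.diag, if_pos rfl] at h3
        norm_num at h3
      refine List.pairwise_append.2 ⟨hp, by simp, fun j hjl i' hi' => ?_⟩
      rw [List.mem_singleton] at hi'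
      subst hi'
      have h3 := hbA j hjl
      rw [(hcb j hjl).2, if_neg (by rintro rfl; exact hil hjl)] at h3
      simpa using h3

/-- The Dynkin diagram of `A`, without its arrows and multiplicities. -/
def diagramGraph (A : Matrix ι ι ℤ) (hA : IsGeneralizedCartanMatrix A) : SimpleGraph ι where
  Adj i j := i ≠ j ∧ A i j ≠ 0
  symm := ⟨fun _ _ h => ⟨h.1.symm, fun h0 => h.2 (hA.zero_symm _ _ h0)⟩⟩
  loopless := ⟨fun _ h => h.1 rfl⟩

theorem weylNumerator_supportedAbove {ρ ν : Dual ℂ H} {k : ι → ℕ}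
    (hk : ∀ i, (ν + ρ) (R.coroot i) = k i) (hk0 : ∀ i, 0 < k i) :
    SupportedAbove k (R.weylNumerator hA ρ ν) := by
  classical
  intro d hd i
  rw [MvPowerSeries.coeff_apply, weylNumerator] at hd
  obtain ⟨w, h⟩ : ∃ w : R.weylGroup hA, (ν + ρ) -
      (w : Dual ℂ H ≃ₗ[ℂ] Dual ℂ H) (ν + ρ) = ∑ i, d i • R.root i := by
    by_contra! hne
    exact hd (finsum_eq_zero_of_forall_eq_zero fun w => by rw [finsum_eq_if, if_neg (hne w)])
  obtain ⟨l, hl, hlen⟩ := R.exists_reduced_word hA w.2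
  obtain ⟨c, hc, hcl, hcn, -⟩ := R.exists_sub_wordProd_apply_eq hA hk hk0 l (by rw [hl, hlen])
  rw [hl, h] at hc
  rw [congrFun (R.eq_of_sum_nsmul_root_eq hc) i]
  by_cases hi : i ∈ l
  · exact Or.inr (hcl i hi)
  · exact Or.inl (hcn i hi)

/-- A contributing `w` attains all lower bounds, so it is a product of commuting reflections with
letter set `I`. This forces `I` to be independent, and the letters alone determine the action of
`w`. -/
theorem coeff_weylNumerator_restrictExponent {ρ ν : Dual ℂ H} {k : ι → ℕ}
    (hk : ∀ i, (ν + ρ) (R.coroot i) = k i) (hk0 : ∀ i, 0 < k i) (I : Finset ι) :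
    MvPowerSeries.coeff (restrictExponent k I) (R.weylNumerator hA ρ ν) =
      indepSign ℂ (diagramGraph A hA) I := by
  classical
  have hsum : ∀ {l : List ι}, (∀ i, i ∈ l ↔ i ∈ I) →
      (∑ j, if j ∈ l then (ν + ρ) (R.coroot j) • R.root j else 0) =
        ∑ i, restrictExponent k I i • R.root i := by
    intro l hl
    refine Finset.sum_congr rfl fun j _ => ?_
    rw [restrictExponent_apply, hk, Nat.cast_smul_eq_nsmul]
    simp only [hl, ite_smul, zero_smul]
  have hfor : ∀ w ∈ R.weylGroup hA,
      (ν + ρ) - w (ν + ρ) = ∑ i, restrictExponent k I i • R.root i →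
      ∃ l : List ι, R.wordProd hA l = w ∧ (∀ i, i ∈ l ↔ i ∈ I) ∧
        l.Pairwise fun i j => A i j = 0 := by
    intro w hw h
    obtain ⟨l, hl, hlen⟩ := R.exists_reduced_word hA hw
    obtain ⟨c, hc, hcl, hcn, hcp⟩ := R.exists_sub_wordProd_apply_eq hA hk hk0 l (by rw [hl, hlen])
    rw [hl, h] at hc
    have hc' : ∀ i, c i = if i ∈ I then k i else 0 := fun i => by
      rw [← restrictExponent_apply, congrFun (R.eq_of_sum_nsmul_root_eq hc) i]
    have hlI : ∀ i, i ∈ l ↔ i ∈ I := by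
      intro i
      have h1 := hc' i
      have h2 := hk0 i
      have h3 := hcl i
      have h4 := hcn i
      grind
    refine ⟨l, hl, hlI, hcp fun i hi => ?_⟩
    rw [hc', if_pos ((hlI i).1 hi)]
  have hindep : ∀ {l : List ι}, (∀ i, i ∈ l ↔ i ∈ I) → (l.Pairwise fun i j => A i j = 0) →
      (diagramGraph A hA).IsIndepSet (I : Set ι) := by
    intro l hl hp i hi j hj hij hadj
    have : Std.Symm fun i j : ι => A i j = 0 := ⟨fun i j => hA.zero_symm i j⟩
    exact hadj.2 (hp.forall ((hl i).2 hi) ((hl j).2 hj) hij)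
  rw [MvPowerSeries.coeff_apply, weylNumerator, indepSign]
  split_ifs with hI
  · have hp : I.toList.Pairwise fun i j => A i j = 0 := by
      refine I.nodup_toList.imp_of_mem fun {i j} hi hj hij => ?_
      by_contra h
      exact hI (Finset.mem_toList.1 hi) (Finset.mem_toList.1 hj) hij ⟨hij, h⟩
    have h1 := R.wordProd_apply_of_pairwise hA hp
    rw [finsum_eq_single _ ⟨R.wordProd hA I.toList, R.wordProd_mem_weylGroup hA _⟩]
    · have h2 : (ν + ρ) - R.wordProd hA I.toList (ν + ρ) =
          ∑ i, restrictExponent k I i • R.root i := by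
        rw [h1, sub_sub_cancel, hsum fun i => Finset.mem_toList]
      rw [finsum_eq_if, if_pos h2]
      simp [sign, det_wordProd]
    · rintro ⟨w, hw⟩ hne
      rw [finsum_eq_if, if_neg]
      intro h
      obtain ⟨l, rfl, hl, hlp⟩ := hfor w hw h
      refine hne (Subtype.ext (LinearEquiv.ext fun x => ?_))
      rw [h1, R.wordProd_apply_of_pairwise hA hlp]
      simp only [hl, Finset.mem_toList]
  · refine finsum_eq_zero_of_forall_eq_zero fun w => ?_
    rw [finsum_eq_if, if_neg]
    intro h
    obtain ⟨l, -, hl, hlp⟩ := hfor w w.2 h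
    exact hI (hindep hl hlp)

/-- The normalized Weyl numerator depends only on the values of the weight at the simple coroots. -/
theorem weylNumerator_congr {ρ ν ν' : Dual ℂ H} (h : ∀ i, ν (R.coroot i) = ν' (R.coroot i)) :
    R.weylNumerator hA ρ ν = R.weylNumerator hA ρ ν' := by
  -- `ν - ν'` vanishes on every coroot, so each simple reflection fixes it.
  have key : ∀ w ∈ R.weylGroup hA, w (ν - ν') = ν - ν' := by
    intro w hw
    obtain ⟨l, rfl⟩ := R.exists_wordProd_eq hA hw
    clear hw
    induction l with
    | nil => simp
    | cons i l ih => rw [wordProd_cons, LinearEquiv.mul_apply, ih, simpleReflection_apply]; simp [h]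
  have h1 : ∀ w ∈ R.weylGroup hA, (ν + ρ) - w (ν + ρ) = (ν' + ρ) - w (ν' + ρ) := by
    intro w hw
    have := key w hw
    simp only [map_sub, map_add] at this ⊢
    rw [← sub_eq_zero] at this ⊢
    rw [← neg_eq_zero, ← this]
    abel
  funext d
  simp only [weylNumerator]
  exact finsum_congr fun w => by rw [h1 w w.2]

end CartanRealization

/-! ### Unique factorization from logarithmic derivatives. -/

section Factorization

open Finset MvPowerSeries

variable {ι : Type*} [Fintype ι] [DecidableEq ι]

/-- Vanishing of an integer combination of logarithmic derivatives of series whose leading terms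
are those of the independence series of a connected graph forces the coefficients to cancel for
every exponent separately. -/
theorem sum_filter_eq_zero_of_sum_eulerLogDerivative_eq_zero (G : SimpleGraph ι)
    (hG : ∀ K : Finset ι, K.Nonempty → K ≠ univ → ∃ a ∈ K, ∃ b ∉ K, G.Adj a b) (i : ι)
    {κ : Type*} [Fintype κ] (F : κ → MvPowerSeries ι ℂ) (k : κ → ι → ℕ) (e : κ → ℤ)
    (hk : ∀ a j, 0 < k a j) (hF : ∀ a, SupportedAbove (k a) (F a))
    (hFG : ∀ a I, coeff (restrictExponent (k a) I) (F a) = indepSign ℂ G I)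
    (hkF : ∀ a b, k a = k b → F a = F b) (h : ∑ a, e a • eulerLogDerivative i (F a) = 0)
    (x : ι → ℕ) : ∑ a with k a = x, e a = 0 := by
  induction x using WellFoundedLT.induction with
  | ind x ih =>
  rcases ({a | k a = x} : Finset κ).eq_empty_or_nonempty with h0 | ⟨b, hb⟩
  · rw [h0, sum_empty]
  have hbx : k b = x := by simpa using hb
  subst hbx
  have h1 := congrArg (coeff (restrictExponent (k b) univ)) h
  rw [map_sum, map_zero, ← sum_fiberwise_of_maps_to (g := k) (t := univ.image k) (by simp),
    sum_eq_single (k b)] at h1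
  · have h2 : ∀ a ∈ ({a | k a = k b} : Finset κ), coeff (restrictExponent (k b) univ)
        (e a • eulerLogDerivative i (F a)) =
        e a • coeff (restrictExponent (k b) univ) (eulerLogDerivative i (F b)) := by
      intro a ha
      rw [hkF a b (by simpa using ha), map_zsmul]
    rw [sum_congr rfl h2, ← sum_smul, smul_eq_zero] at h1
    exact h1.resolve_right (coeff_eulerLogDerivative_ne_zero (hk b) (hF b) G (hFG b) hG i)
  · intro y hy hyb
    obtain ⟨c, -, rfl⟩ := mem_image.1 hy
    have h2 : ∀ a ∈ ({a | k a = k c} : Finset κ), coeff (restrictExponent (k b) univ)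
        (e a • eulerLogDerivative i (F a)) =
        e a • coeff (restrictExponent (k b) univ) (eulerLogDerivative i (F c)) := by
      intro a ha
      rw [hkF a c (by simpa using ha), map_zsmul]
    rw [sum_congr rfl h2, ← sum_smul, smul_eq_zero]
    -- Smaller exponents cancel by induction. The others do not reach the monomial: its exponents
    -- are all positive, so the gap property would force `k c ≤ k b`.
    by_cases hle : k c ≤ k b
    · exact Or.inl (ih _ (lt_of_le_of_ne hle hyb))
    · right
      by_contra hne
      refine hle fun j => ?_
      have h3 := (hF c).eulerLogDerivative i _ hne j
      rw [restrictExponent_apply, if_pos (mem_univ j)] at h3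
      exact h3.resolve_left (hk b j).ne'
  · intro hn
    exact absurd (mem_image_of_mem k (mem_univ b)) hn

/-- Products of series whose leading terms are those of the independence series of a connected
graph determine their factors up to order. -/
theorem exists_equiv_of_prod_eq_prod (G : SimpleGraph ι)
    (hG : ∀ K : Finset ι, K.Nonempty → K ≠ univ → ∃ a ∈ K, ∃ b ∉ K, G.Adj a b) (i : ι)
    {κ κ' : Type*} [Fintype κ] [Fintype κ'] (F : κ ⊕ κ' → MvPowerSeries ι ℂ)
    (k : κ ⊕ κ' → ι → ℕ) (hk : ∀ a j, 0 < k a j) (hF : ∀ a, SupportedAbove (k a) (F a))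
    (hFG : ∀ a I, coeff (restrictExponent (k a) I) (F a) = indepSign ℂ G I)
    (hkF : ∀ a b, k a = k b → F a = F b) (h : ∏ a, F (Sum.inl a) = ∏ b, F (Sum.inr b)) :
    ∃ σ : κ ≃ κ', ∀ a, F (Sum.inl a) = F (Sum.inr (σ a)) := by
  have hF0 : ∀ a, constantCoeff (F a) ≠ 0 := by
    intro a
    have h0 : restrictExponent (k a) ∅ = 0 := by
      ext j
      simp [restrictExponent_apply]
    rw [← coeff_zero_eq_constantCoeff_apply, ← h0, hFG]
    simp [indepSign]
  have h1 := congrArg (eulerLogDerivative i) h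
  rw [eulerLogDerivative_prod i _ _ fun a _ => hF0 _,
    eulerLogDerivative_prod i _ _ fun a _ => hF0 _] at h1
  -- With weights `1` on the left factors and `-1` on the right ones, cancellation for each exponent
  -- says that it has equally many factors on both sides.
  have h2 := sum_filter_eq_zero_of_sum_eulerLogDerivative_eq_zero G hG i F k
    (Sum.elim (fun _ => 1) fun _ => -1) hk hF hFG hkF (by simp [h1])
  have h3 : ∀ x, Fintype.card {a // k (Sum.inl a) = x} = Fintype.card {b // k (Sum.inr b) = x} := by
    intro x
    have := h2 x
    rw [sum_filter, Fintype.sum_sum_type] at this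
    simp only [Sum.elim_inl, Sum.elim_inr, ← sum_filter, sum_const] at this
    rw [Fintype.card_subtype, Fintype.card_subtype]
    simp at this
    omega
  refine ⟨Equiv.ofFiberEquiv fun x => Fintype.equivOfCardEq (h3 x), fun a => hkF _ _ ?_⟩
  exact (Equiv.ofFiberEquiv_map (fun x => Fintype.equivOfCardEq (h3 x)) a).symm

end Factorization

theorem IsIndecomposableMatrix.exists_diagramGraph_adj {ι : Type*} [Fintype ι] {A : Matrix ι ι ℤ}
    (hindec : IsIndecomposableMatrix A) (hA : IsGeneralizedCartanMatrix A) (K : Finset ι)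
    (hK : K.Nonempty) (hK' : K ≠ Finset.univ) :
    ∃ a ∈ K, ∃ b ∉ K, (CartanRealization.diagramGraph A hA).Adj a b := by
  obtain ⟨a, ha, b, hb, hab⟩ := hindec.2 K (by simpa using hK) (by
    rw [Set.nonempty_compl]
    exact_mod_cast hK')
  refine ⟨a, by simpa using ha, b, by simpa using hb, fun h => hb (h ▸ ha), fun h0 => ?_⟩
  exact hab.elim (fun h => h h0) fun h => h (hA.zero_symm a b h0)

theorem theorem3p4 {ι : Type*} [Fintype ι] [DecidableEq ι] (A : Matrix ι ι ℤ)
    (hA : IsGeneralizedCartanMatrix A) (hsymm : IsSymmetrizableMatrix A)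
    (hindec : IsIndecomposableMatrix A)
    (𝔤 : Type*) [LieRing 𝔤] [LieAlgebra ℂ 𝔤] (K : KacMoodyAlgebra A 𝔤)
    (ρ : Module.Dual ℂ K.cartan) (hρ : K.realization.IsWeylVector ρ)
    (n m : ℕ) (hn : 0 < n) (hm : 0 < m)
    (lam : Fin n → Module.Dual ℂ K.cartan) (mu : Fin m → Module.Dual ℂ K.cartan)
    (hlam : ∀ i, lam i ∈ K.realization.dominantWeights)
    (hmu : ∀ j, mu j ∈ K.realization.dominantWeights)
    (h : ∏ i, K.realization.weylNumerator hA ρ (lam i) =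
      ∏ j, K.realization.weylNumerator hA ρ (mu j)) :
    n = m ∧ ∃ σ : Fin n ≃ Fin m, ∀ i,
      K.realization.weylNumerator hA ρ (lam i) =
        K.realization.weylNumerator hA ρ (mu (σ i)) := by
  obtain ⟨i⟩ := hindec.1
  choose kl hkl using hlam
  choose km hkm using hmu
  let wt : Fin n ⊕ Fin m → Module.Dual ℂ K.cartan := Sum.elim lam mu
  -- The `+ 1` is the value of `ρ` at a coroot; it makes every exponent positive.
  let k : Fin n ⊕ Fin m → ι → ℕ := Sum.elim (fun a j => kl a j + 1) fun b j => km b j + 1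
  have hk : ∀ a j, (wt a + ρ) (K.realization.coroot j) = k a j := by
    rintro (a | b) j
    · simp [wt, k, hkl, hρ j]
    · simp [wt, k, hkm, hρ j]
  have hk0 : ∀ a j, 0 < k a j := by
    rintro (a | b) j <;> exact Nat.succ_pos _
  obtain ⟨σ, hσ⟩ := exists_equiv_of_prod_eq_prod (CartanRealization.diagramGraph A hA)
    (hindec.exists_diagramGraph_adj hA) i (fun a => K.realization.weylNumerator hA ρ (wt a)) k hk0
    (fun a => K.realization.weylNumerator_supportedAbove hA (hk a) (hk0 a))
    (fun a => K.realization.coeff_weylNumerator_restrictExponent hA (hk a) (hk0 a))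
    (fun a b hab => K.realization.weylNumerator_congr hA fun j => by
      have h1 := hk a j
      rw [hab, ← hk b j] at h1
      simpa using h1) h
  exact ⟨by simpa using Fintype.card_congr σ, σ, hσ⟩
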